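/- Let $S$ be a compact Polish space, $P(S)$ the set of Borel probability measures on $S$, $f:S\to\mathbb R$ and $c:S\times S\to[0,\infty)$ lower semicontinuous, $\mu\in P(S)$ and $r>0$. Let $X$ be the set of Borel probability measures $\pi$ on $S\times S$ with first marginal $\mu$ (and arbitrary second marginal), and for $\nu\in P(S)$ let $$d_c(\mu,\nu)=\inf\Big\{\int_{S\times S} c\,d\pi:\ \pi\text{ has marginals }\mu\text{ and }\nu\Big\}.$$ For $\lambda\ge 0$ put $\phi_\lambda(x)=\inf_{y\in S}\{f(y)+\lambda c(x,y)\}$ and, for $\pi\in X$, $$L(\pi,\lambda)=\int_{S\times S}\big(f(y)+\lambda c(x,y)\big)\,d\pi(x,y)-\lambda r.$$ All integrands are bounded below, integrals take values in $(-\infty,+\infty]$, and $\inf\emptyset=+\infty$. Then: 1. The following equalities hold in the extended reals: $$\inf_{\nu\in P(S),\ d_c(\mu,\nu)\le r}\int_S f\,d\nu\;=\;\inf_{\pi\in X,\ \int c\,d\pi\le r}\int_{S\times S} f(y)\,d\pi(x,y)\;=\;\sup_{\lambda\ge 0}\Big\{\int_S\phi_\lambda\,d\mu-\lambda r\Big\}.$$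 2. For all $\lambda\ge0$ and $x\in S$ the infimum defining $\phi_\lambda(x)$ is a minimum. 3. For every $\lambda\ge 0$ there is a Borel map $T:S\to S$ with $T(x)\in\arg\min_{y\in S}\{f(y)+\lambda c(x,y)\}$ for all $x\in S$; and for every such $T$ the deterministic coupling $\pi^*=(\mathrm{Id},T)_\#\mu$ belongs to $X$ and satisfies $$L(\pi^*,\lambda)=\min_{\pi\in X}L(\pi,\lambda)=\int_S\phi_\lambda\,d\mu-\lambda r.$$ -/

import Mathlib

open MeasureTheory
open scoped NNReal ENNReal

noncomputable section

namespace OTDuality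

/-- The integral of a real function with values in the extended reals, `∫ g⁺ dm - ∫ g⁻ dm`.
It is the usual (quasi-)integral whenever `∫ g⁻ dm < ∞`; in particular it is meaningful, with a
value in `(-∞, +∞]`, for measurable functions that are bounded below and `m` finite. -/
def extInt {X : Type*} [MeasurableSpace X] (m : Measure X) (g : X → ℝ) : EReal :=
  ((∫⁻ x, ENNReal.ofReal (g x) ∂m : ℝ≥0∞) : EReal)
    - ((∫⁻ x, ENNReal.ofReal (-g x) ∂m : ℝ≥0∞) : EReal)

/-- `Π(P, Q)`: the transport plans (couplings) from some measure in `P` to some measure in `Q`. -/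
def transportPlans {X Y : Type*} [MeasurableSpace X] [MeasurableSpace Y]
    (P : Set (ProbabilityMeasure X)) (Q : Set (ProbabilityMeasure Y)) :
    Set (ProbabilityMeasure (X × Y)) :=
  {π | π.map measurable_fst.aemeasurable ∈ P ∧ π.map measurable_snd.aemeasurable ∈ Q}

variable {S : Type*} [MeasurableSpace S]

/-- Total cost `∫ c dπ` of a plan, possibly infinite. -/
def planCost (c : S × S → ℝ≥0) (π : ProbabilityMeasure (S × S)) : ℝ≥0∞ :=
  ∫⁻ p, (c p : ℝ≥0∞) ∂(π : Measure (S × S))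

/-- The optimal transport cost `d_c(μ, ν)`. -/
def transportCost (c : S × S → ℝ≥0) (μ ν : ProbabilityMeasure S) : ℝ≥0∞ :=
  ⨅ π ∈ transportPlans {μ} {ν}, planCost c π

/-- The uncertainty set `B_r(μ)`. -/
def uncertaintySet (c : S × S → ℝ≥0) (μ : ProbabilityMeasure S) (r : ℝ) :
    Set (ProbabilityMeasure S) :=
  {ν | transportCost c μ ν ≤ ENNReal.ofReal r}

/-- All transport plans with first marginal `μ` and arbitrary second marginal. -/
def plansFrom (μ : ProbabilityMeasure S) : Set (ProbabilityMeasure (S × S)) :=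
  transportPlans {μ} Set.univ

/-- The primal value: infimum of `E_ν f` over `ν ∈ B_r(μ)` (`+∞` if there is no such `ν`). -/
def primalValue (f : S → ℝ) (c : S × S → ℝ≥0) (μ : ProbabilityMeasure S) (r : ℝ) : EReal :=
  ⨅ ν ∈ uncertaintySet c μ r, extInt (ν : Measure S) f

/-- The primal value over transport plans: infimum of `∫ f(y) dπ(x,y)` over the plans `π` from `μ`
with `∫ c dπ ≤ r`. -/
def primalPlanValue (f : S → ℝ) (c : S × S → ℝ≥0) (μ : ProbabilityMeasure S) (r : ℝ) : EReal :=
  ⨅ π ∈ {π ∈ plansFrom μ | planCost c π ≤ ENNReal.ofReal r},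
    extInt (π : Measure (S × S)) (fun p => f p.2)

/-- The Lagrangian `L(π, l) = ∫ (f(y) + l c(x,y)) dπ(x,y) - l r`. -/
def lagrangian (f : S → ℝ) (c : S × S → ℝ≥0) (r : ℝ) (π : ProbabilityMeasure (S × S))
    (l : ℝ≥0) : EReal :=
  extInt (π : Measure (S × S)) (fun p => f p.2 + l * c p) - ((l * r : ℝ) : EReal)

/-- `φ_l(x) = inf_y {f(y) + l c(x,y)}`. -/
def phi {S : Type*} (f : S → ℝ) (c : S × S → ℝ≥0) (l : ℝ≥0) (x : S) : ℝ :=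
  ⨅ y, (f y + l * c (x, y))

/-- The dual value `sup_{l ≥ 0} {∫ φ_l dμ - l r}`. -/
def dualValue (f : S → ℝ) (c : S × S → ℝ≥0) (μ : ProbabilityMeasure S) (r : ℝ) : EReal :=
  ⨆ l : ℝ≥0, (extInt (μ : Measure S) (phi f c l) - ((l * r : ℝ) : EReal))

/-- `T` selects, for every `x`, a minimiser of `y ↦ f(y) + l c(x,y)`. -/
def IsMinimiserSelection {S : Type*} (f : S → ℝ) (c : S × S → ℝ≥0) (l : ℝ≥0) (T : S → S) : Prop :=
  ∀ x y, f (T x) + l * c (x, T x) ≤ f y + l * c (x, y)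

/-- The deterministic coupling `(Id, T)_# μ`. -/
def deterministicPlan (μ : ProbabilityMeasure S) (T : S → S) (hT : Measurable T) :
    ProbabilityMeasure (S × S) :=
  μ.map (f := fun x => (x, T x)) (measurable_id.prodMk hT).aemeasurable

end OTDuality

end

namespace OTDuality

open Filter Topology

/-! Weak duality integrates `φ_l(x) ≤ f(y) + l c(x,y)` against a plan whose cost is nearly `d_c(μ,
ν)`. Each feasible plan has a feasible second marginal, so dual ≤ primal ≤ plan value, and only plan
value ≤ dual is left.

For this, take a real `a` strictly below the plan value. Plans from `μ` form a compact convex set on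
which cost and shifted objective are affine and lower semicontinuous (layer cake, portmanteau,
Fatou). The (cost, value) pairs dominating some plan therefore form a closed convex subset of the
quadrant that misses `(r, a)` after the shift. A separating line yields a multiplier `l` with `a + l
r ≤ ∫ (f(y) + l c) dπ` for every plan `π` (`exists_multiplier`). At the plan `(Id, T)_# μ`, with `T`
a Borel selection of minimisers, the right side is `∫ φ_l dμ`, so `a` is at most the dual value. No
minimax theorem is needed.

The selection refines the argmin sets by successively minimising the distance to the points of a
dense sequence. -/

/-! ### Measurable selection of minimisers on a compact space -/

/-- The minimisers of `u` over the set `A`. -/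
def argminOn {Y : Type*} (A : Set Y) (u : Y → ℝ) : Set Y :=
  {y ∈ A | ∀ z ∈ A, u y ≤ u z}

lemma isClosed_argminOn {Y : Type*} [TopologicalSpace Y] {A : Set Y} (hA : IsClosed A)
    {u : Y → ℝ} (hu : LowerSemicontinuous u) : IsClosed (argminOn A u) := by
  have : argminOn A u = A ∩ ⋂ z ∈ A, u ⁻¹' Set.Iic (u z) := by
    ext y; simp [argminOn]
  rw [this]
  exact hA.inter (isClosed_biInter fun z _ => hu.isClosed_preimage _)

lemma argminOn_nonempty {Y : Type*} [TopologicalSpace Y] [CompactSpace Y] {A : Set Y}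
    (hA : IsClosed A) (hne : A.Nonempty) {u : Y → ℝ} (hu : LowerSemicontinuous u) :
    (argminOn A u).Nonempty := by
  obtain ⟨y, hy, hmin⟩ :=
    LowerSemicontinuousOn.exists_isMinOn hne hA.isCompact (hu.lowerSemicontinuousOn A)
  exact ⟨y, hy, fun z hz => hmin hz⟩

/-- A multifunction with nonempty closed values whose preimages of closed sets are measurable. -/
structure IsClosedMeasurable {X Y : Type*} [MeasurableSpace X] [TopologicalSpace Y]
    (A : X → Set Y) : Prop where
  isClosed : ∀ x, IsClosed (A x)
  nonempty : ∀ x, (A x).Nonempty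
  measurableSet : ∀ F, IsClosed F → MeasurableSet {x | (A x ∩ F).Nonempty}

/-- The multifunction of minimisers is measurable as soon as sublevel sets are. -/
lemma isClosedMeasurable_argminOn {X Y : Type*} [MeasurableSpace X] [TopologicalSpace Y]
    [CompactSpace Y] {A : X → Set Y} (hA : ∀ x, IsClosed (A x)) (hne : ∀ x, (A x).Nonempty)
    {u : X → Y → ℝ} (hu : ∀ x, LowerSemicontinuous (u x))
    (hm : ∀ F, IsClosed F → ∀ q : ℝ, MeasurableSet {x | ∃ y ∈ A x ∩ F, u x y ≤ q}) :
    IsClosedMeasurable fun x => argminOn (A x) (u x) where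
  isClosed x := isClosed_argminOn (hA x) (hu x)
  nonempty x := argminOn_nonempty (hA x) (hne x) (hu x)
  measurableSet F hF := by
    -- The argmin misses `F` exactly when the minimum over `A x ∩ F` exceeds the minimum over `A x`,
    -- or `A x ∩ F` is empty. A rational witnesses either case, making the union countable.
    have key : {x | (argminOn (A x) (u x) ∩ F).Nonempty}ᶜ =
        ⋃ q : ℚ, {x | ∃ y ∈ A x ∩ Set.univ, u x y ≤ q} \ {x | ∃ y ∈ A x ∩ F, u x y ≤ q} := by
      ext x
      simp only [Set.mem_compl_iff, Set.mem_ofPred_eq, Set.mem_iUnion, Set.mem_sdiff,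
        Set.inter_univ]
      constructor
      · intro h
        by_cases hAF : (A x ∩ F).Nonempty
        · obtain ⟨y, hy, hmin⟩ := argminOn_nonempty ((hA x).inter hF) hAF (hu x)
          have : ∃ z ∈ A x, u x z < u x y := by
            by_contra! hcon
            exact h ⟨y, ⟨hy.1, hcon⟩, hy.2⟩
          obtain ⟨z, hz, hzy⟩ := this
          obtain ⟨q, hq1, hq2⟩ := exists_rat_btwn hzy
          refine ⟨q, ⟨z, hz, hq1.le⟩, ?_⟩
          rintro ⟨w, hw, hwq⟩
          exact absurd (hmin w hw) (not_le.2 (hwq.trans_lt hq2))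
        · obtain ⟨y, hy⟩ := hne x
          obtain ⟨q, hq⟩ := exists_rat_gt (u x y)
          exact ⟨q, ⟨y, hy, hq.le⟩, fun ⟨w, hw, _⟩ => hAF ⟨w, hw⟩⟩
      · rintro ⟨q, ⟨z, hz, hzq⟩, hn⟩ ⟨y, hy, hyF⟩
        exact hn ⟨y, ⟨hy.1, hyF⟩, (hy.2 z hz).trans hzq⟩
    rw [← MeasurableSet.compl_iff, key]
    exact .iUnion fun q => (hm _ isClosed_univ q).diff (hm _ hF q)

/-- A closed-valued measurable multifunction into a compact metrizable space has a measurable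
selection. -/
theorem IsClosedMeasurable.exists_measurable_selection {X Y : Type*} [MeasurableSpace X]
    [TopologicalSpace Y] [TopologicalSpace.MetrizableSpace Y] [CompactSpace Y]
    [MeasurableSpace Y] [BorelSpace Y] {A : X → Set Y} (hA : IsClosedMeasurable A) :
    ∃ T : X → Y, Measurable T ∧ ∀ x, T x ∈ A x := by
  let _ : MetricSpace Y := TopologicalSpace.metrizableSpaceMetric Y
  rcases isEmpty_or_nonempty X with hX | ⟨⟨x₀⟩⟩
  · exact ⟨fun x => (hX.false x).elim, measurable_of_empty _, fun x => (hX.false x).elim⟩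
  have : Nonempty Y := ⟨(hA.nonempty x₀).some⟩
  let s := TopologicalSpace.denseSeq Y
  -- `B (n + 1) x` keeps the points of `B n x` nearest to `s n`. Points common to all `B n x` have
  -- equal distances to a dense set, hence coincide.
  let B : ℕ → X → Set Y := fun n =>
    Nat.rec A (fun n An x => argminOn (An x) fun y => dist y (s n)) n
  have hBs : ∀ n x, B (n + 1) x = argminOn (B n x) fun y => dist y (s n) := fun _ _ => rfl
  have hdist : ∀ n, Continuous fun y => dist y (s n) := fun n => by fun_prop
  have hB : ∀ n, IsClosedMeasurable (B n) := by
    intro n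
    induction n with
    | zero => exact hA
    | succ n ih =>
      refine isClosedMeasurable_argminOn ih.isClosed ih.nonempty
        (fun _ => (hdist n).lowerSemicontinuous) fun F hF q => ?_
      -- The sublevel condition is a closed condition on `y` alone, so it can be absorbed into the
      -- test set.
      have := ih.measurableSet (F ∩ {y | dist y (s n) ≤ q})
        (hF.inter (isClosed_le (hdist n) continuous_const))
      convert this using 3 with x
      simp only [Set.Nonempty, Set.mem_inter_iff, Set.mem_ofPred_eq, and_assoc]
  have hanti : ∀ x n, B (n + 1) x ⊆ B n x := fun x n y hy => hy.1
  -- Cantor intersection; the set `F` is carried along so that `T ⁻¹' F` becomes a countable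
  -- intersection below.
  have hinter : ∀ x F, IsClosed F → (∀ n, (B n x ∩ F).Nonempty) → (⋂ n, B n x ∩ F).Nonempty :=
    fun x F hF h => IsCompact.nonempty_iInter_of_sequence_nonempty_isCompact_isClosed _
      (fun n => Set.inter_subset_inter_left _ (hanti x n)) h
      (((hB 0).isClosed x).inter hF).isCompact fun n => ((hB n).isClosed x).inter hF
  have hex : ∀ x, ∃ y, ∀ n, y ∈ B n x := fun x => by
    obtain ⟨y, hy⟩ := hinter x Set.univ isClosed_univ (by simpa using fun n => (hB n).nonempty x)
    exact ⟨y, by simpa using hy⟩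
  choose T hT using hex
  have huniq : ∀ x y, (∀ n, y ∈ B n x) → y = T x := by
    intro x y hy
    have heq : ∀ n, dist y (s n) = dist (T x) (s n) := fun n =>
      le_antisymm ((hy (n + 1)).2 _ (hT x n)) ((hT x (n + 1)).2 _ (hy n))
    have : (fun z => dist y z) = fun z => dist (T x) z :=
      (TopologicalSpace.denseRange_denseSeq Y).equalizer (by fun_prop) (by fun_prop)
        (funext heq)
    simpa using congrFun this (T x)
  refine ⟨T, measurable_of_isClosed fun F hF => ?_, fun x => hT x 0⟩
  have : T ⁻¹' F = ⋂ n, {x | (B n x ∩ F).Nonempty} := by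
    ext x
    simp only [Set.mem_preimage, Set.mem_iInter, Set.mem_ofPred_eq]
    refine ⟨fun h n => ⟨T x, hT x n, h⟩, fun h => ?_⟩
    obtain ⟨y, hy⟩ := hinter x F hF h
    simp only [Set.mem_iInter, Set.mem_inter_iff] at hy
    rw [← huniq x y fun n => (hy n).1]
    exact (hy 0).2
  rw [this]
  exact .iInter fun n => (hB n).measurableSet F hF

/-! ### Lower semicontinuity of integrals and Lagrange multipliers -/

/-- For `g ≥ 0` lower semicontinuous, `m ↦ ∫ g dm` is lower semicontinuous for the weak topology. -/
theorem lowerSemicontinuous_lintegral {Ω : Type*} [TopologicalSpace Ω]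
    [TopologicalSpace.PseudoMetrizableSpace Ω] [TopologicalSpace.SeparableSpace Ω]
    [MeasurableSpace Ω] [BorelSpace Ω] {g : Ω → ℝ} (hg : LowerSemicontinuous g) (h0 : 0 ≤ g) :
    LowerSemicontinuous fun m : ProbabilityMeasure Ω =>
      ∫⁻ x, ENNReal.ofReal (g x) ∂(m : Measure Ω) := by
  rw [lowerSemicontinuous_iff_le_liminf]
  intro m
  -- Layer cake: the superlevel sets of `g` are open, so portmanteau applies for each `t`, and Fatou
  -- in `t` concludes.
  simp_rw [lintegral_eq_lintegral_meas_lt _ (Eventually.of_forall h0) hg.measurable.aemeasurable]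
  calc ∫⁻ t in Set.Ioi (0 : ℝ), (m : Measure Ω) {a | t < g a}
      ≤ ∫⁻ t in Set.Ioi (0 : ℝ),
          (𝓝 m).liminf fun m' : ProbabilityMeasure Ω => (m' : Measure Ω) {a | t < g a} :=
        lintegral_mono fun t =>
          ProbabilityMeasure.le_liminf_measure_open_of_tendsto tendsto_id (hg.isOpen_preimage t)
    _ ≤ _ := lintegral_liminf_le fun m' => Antitone.measurable fun s t hst =>
        measure_mono fun ω hω => lt_of_le_of_lt hst hω

/-- A convex closed upward-closed part of the quadrant that misses `(r, a)` is separated from it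
by a line with positive slope coefficient. -/
lemma exists_pos_slope {D : Set (ℝ × ℝ)} (hconv : Convex ℝ D) (hclosed : IsClosed D)
    (hpos : ∀ p ∈ D, 0 ≤ p.1 ∧ 0 ≤ p.2)
    (hup : ∀ p ∈ D, ∀ q : ℝ × ℝ, p.1 ≤ q.1 → p.2 ≤ q.2 → q ∈ D)
    {r a : ℝ} (hr : 0 < r) (ha : 0 ≤ a) (hra : (r, a) ∉ D) :
    ∃ l : ℝ, 0 < l ∧ ∀ p ∈ D, a + l * r ≤ p.2 + l * p.1 := by
  rcases D.eq_empty_or_nonempty with rfl | ⟨p₀, hp₀⟩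
  · exact ⟨1, one_pos, by simp⟩
  obtain ⟨F, u, hu, hF⟩ := geometric_hahn_banach_point_closed hconv hclosed hra
  set α := F (1, 0) with hα
  set β := F (0, 1) with hβ
  have hFp : ∀ p : ℝ × ℝ, F p = α * p.1 + β * p.2 := by
    intro p
    have : p = p.1 • ((1, 0) : ℝ × ℝ) + p.2 • ((0, 1) : ℝ × ℝ) := by ext <;> simp
    conv_lhs => rw [this]
    rw [map_add, map_smul, map_smul, smul_eq_mul, smul_eq_mul]
    ring
  -- `D` is stable under moving right or up, so a negative coefficient would make `F` unbounded
  -- below on `D`.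
  have hlow : ∀ s t : ℝ, 0 ≤ s → 0 ≤ t → u < F p₀ + (α * s + β * t) := by
    intro s t hs ht
    have := hF (p₀.1 + s, p₀.2 + t) (hup p₀ hp₀ _ (by simpa) (by simpa))
    rw [hFp] at this ⊢
    simp only at this
    linarith
  have hα0 : 0 ≤ α := by
    by_contra! h
    obtain ⟨n, hn⟩ := exists_nat_gt ((F p₀ - u) / -α)
    have := hlow n 0 (by positivity) le_rfl
    rw [div_lt_iff₀ (by linarith)] at hn
    nlinarith
  have hβ0 : 0 ≤ β := by
    by_contra! h
    obtain ⟨n, hn⟩ := exists_nat_gt ((F p₀ - u) / -β)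
    have := hlow 0 n le_rfl (by positivity)
    rw [div_lt_iff₀ (by linarith)] at hn
    nlinarith
  set δ := u - (α * r + β * a) with hδ
  have hδ0 : 0 < δ := by rw [hFp] at hu; simp only at hu; linarith
  have hgap : ∀ p ∈ D, α * r + β * a + δ ≤ α * p.1 + β * p.2 := by
    intro p hp
    have := hF p hp
    rw [hFp] at this
    linarith
  -- If `β = 0` the line is vertical and `p.1 ≥ r + δ / α` on `D`: a slope steep enough gains `a +
  -- 1` across this gap. If `β > 0`, the slope `α / β` already works; the gap pays for the extra `δ
  -- / (β * r)`, which makes `l` positive even when `α = 0`.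
  rcases hβ0.eq_or_lt with hb | hb
  · rw [← hb] at hgap
    have hα1 : 0 < α := by
      rcases hα0.eq_or_lt with h | h
      · have := hgap p₀ hp₀
        rw [← h] at this
        linarith
      · exact h
    refine ⟨(a + 1) * α / δ, by positivity, fun p hp => ?_⟩
    have h1 := hgap p hp
    have h2 := (hpos p hp).2
    have h3 : (a + 1) / δ * δ = a + 1 := by field_simp
    have h4 : (a + 1) / δ * (α * r + δ) ≤ (a + 1) / δ * (α * p.1) :=
      mul_le_mul_of_nonneg_left (by linarith) (by positivity)
    have e1 : (a + 1) * α / δ * r = (a + 1) / δ * (α * r) := by ring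
    have e2 : (a + 1) * α / δ * p.1 = (a + 1) / δ * (α * p.1) := by ring
    rw [e1, e2]
    linarith
  · refine ⟨α / β + δ / (β * r), by positivity, fun p hp => ?_⟩
    have h1 := hgap p hp
    have h2 : 0 ≤ δ / (β * r) * p.1 := mul_nonneg (by positivity) (hpos p hp).1
    have h3 : δ / (β * r) * r = δ / β := by field_simp
    have h4 : β⁻¹ * (α * r + β * a + δ) ≤ β⁻¹ * (α * p.1 + β * p.2) :=
      mul_le_mul_of_nonneg_left h1 (by positivity)
    have e1 : β⁻¹ * (α * r + β * a + δ) = α / β * r + a + δ / β := by field_simp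
    have e2 : β⁻¹ * (α * p.1 + β * p.2) = α / β * p.1 + p.2 := by field_simp
    rw [e1, e2] at h4
    rw [add_mul, add_mul, h3]
    linarith

/-- Existence of a Lagrange multiplier for the minimisation of `G` under the constraint `C ≤ r`,
over a compact set on which `C` and `G` are lower semicontinuous and convex. -/
theorem exists_multiplier {P : Type*} [TopologicalSpace P] {K : Set P} (hK : IsCompact K)
    {C G : P → ℝ≥0∞} (hC : LowerSemicontinuous C) (hG : LowerSemicontinuous G)
    (hconv : ∀ x ∈ K, ∀ y ∈ K, ∀ s t : ℝ≥0, s + t = 1 →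
      ∃ z ∈ K, C z ≤ s * C x + t * C y ∧ G z ≤ s * G x + t * G y)
    {r a : ℝ≥0} (hr : 0 < r) (hra : ∀ x ∈ K, C x ≤ r → a < G x) :
    ∃ l : ℝ≥0, ∀ x ∈ K, (a + l * r : ℝ≥0∞) ≤ G x + l * C x := by
  -- The sign conditions matter because `ENNReal.ofReal` truncates negative numbers to `0`.
  let D : Set (ℝ × ℝ) := {p | (0 ≤ p.1 ∧ 0 ≤ p.2) ∧
    ∃ x ∈ K, C x ≤ ENNReal.ofReal p.1 ∧ G x ≤ ENNReal.ofReal p.2}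
  -- Up to the sign conditions, `D` is the projection of a closed set along the compact `K`.
  have hDclosed : IsClosed D := by
    have h1 : IsClosed {p : P × (ℝ × ℝ) | C p.1 ≤ ENNReal.ofReal p.2.1 ∧
        G p.1 ≤ ENNReal.ofReal p.2.2} :=
      (hC.isClosed_epigraph.preimage (f := fun p : P × (ℝ × ℝ) => (p.1, ENNReal.ofReal p.2.1))
        (continuous_fst.prodMk (ENNReal.continuous_ofReal.comp (by fun_prop)))).inter
      (hG.isClosed_epigraph.preimage (f := fun p : P × (ℝ × ℝ) => (p.1, ENNReal.ofReal p.2.2))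
        (continuous_fst.prodMk (ENNReal.continuous_ofReal.comp (by fun_prop))))
    have : CompactSpace K := isCompact_iff_compactSpace.1 hK
    have h2 := isClosedMap_snd_of_compactSpace (X := K) (Y := ℝ × ℝ) _
      (h1.preimage (f := fun p : K × (ℝ × ℝ) => ((p.1 : P), p.2)) (by fun_prop))
    have h3 : IsClosed {p : ℝ × ℝ | 0 ≤ p.1 ∧ 0 ≤ p.2} :=
      (isClosed_le continuous_const continuous_fst).inter
        (isClosed_le continuous_const continuous_snd)
    convert h3.inter h2 using 1
    ext p
    simp [D, and_left_comm]
  have hDconv : Convex ℝ D := by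
    rintro p ⟨⟨hp1, hp2⟩, x, hx, hxC, hxG⟩ q ⟨⟨hq1, hq2⟩, y, hy, hyC, hyG⟩ s t hs ht hst
    lift s to ℝ≥0 using hs
    lift t to ℝ≥0 using ht
    obtain ⟨z, hz, hzC, hzG⟩ := hconv x hx y hy s t (by exact_mod_cast hst)
    have comb : ∀ v w : ℝ, 0 ≤ v → 0 ≤ w → (s * ENNReal.ofReal v + t * ENNReal.ofReal w : ℝ≥0∞) =
        ENNReal.ofReal (s * v + t * w) := by
      intro v w hv hw
      rw [ENNReal.ofReal_add (by positivity) (by positivity), ENNReal.ofReal_mul (by positivity),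
        ENNReal.ofReal_mul (by positivity), ENNReal.ofReal_coe_nnreal, ENNReal.ofReal_coe_nnreal]
    refine ⟨⟨?_, ?_⟩, z, hz, ?_, ?_⟩
    · simp only [Prod.fst_add, Prod.smul_fst, smul_eq_mul]; positivity
    · simp only [Prod.snd_add, Prod.smul_snd, smul_eq_mul]; positivity
    · simp only [Prod.fst_add, Prod.smul_fst, smul_eq_mul]
      rw [← comb _ _ hp1 hq1]
      exact hzC.trans (by gcongr)
    · simp only [Prod.snd_add, Prod.smul_snd, smul_eq_mul]
      rw [← comb _ _ hp2 hq2]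
      exact hzG.trans (by gcongr)
  have hnot : ((r : ℝ), (a : ℝ)) ∉ D := by
    rintro ⟨-, x, hx, hxC, hxG⟩
    rw [ENNReal.ofReal_coe_nnreal] at hxC hxG
    exact absurd hxG (not_le.2 (hra x hx hxC))
  obtain ⟨l, hl, hle⟩ := exists_pos_slope hDconv hDclosed (fun p hp => hp.1)
    (fun p hp q h1 h2 => ⟨⟨hp.1.1.trans h1, hp.1.2.trans h2⟩, hp.2.imp fun x hx =>
      ⟨hx.1, hx.2.1.trans (ENNReal.ofReal_le_ofReal h1),
        hx.2.2.trans (ENNReal.ofReal_le_ofReal h2)⟩⟩) (by exact_mod_cast hr) a.2 hnot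
  lift l to ℝ≥0 using hl.le
  refine ⟨l, fun x hx => ?_⟩
  -- Points with `C x = ∞` do not enter `D`; positivity of `l` is needed for them, since `0 * ∞ =
  -- 0`.
  have hl0 : (l : ℝ≥0∞) ≠ 0 := by
    have : l ≠ 0 := by rintro rfl; simp at hl
    exact_mod_cast this
  by_cases hCx : C x = ∞
  · simp [hCx, ENNReal.mul_top hl0]
  by_cases hGx : G x = ∞
  · simp [hGx]
  have := hle ((C x).toReal, (G x).toReal) ⟨⟨by positivity, by positivity⟩, x, hx,
    by simp [ENNReal.ofReal_toReal hCx], by simp [ENNReal.ofReal_toReal hGx]⟩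
  lift C x to ℝ≥0 using hCx with cx
  lift G x to ℝ≥0 using hGx with gx
  simp only [ENNReal.coe_toReal] at this
  exact_mod_cast this

/-! ### The extended integral -/

lemma extInt_mono {X : Type*} [MeasurableSpace X] (m : Measure X) {g h : X → ℝ}
    (hgh : ∀ x, g x ≤ h x) : extInt m g ≤ extInt m h :=
  EReal.sub_le_sub
    (EReal.coe_ennreal_le_coe_ennreal_iff.2
      (lintegral_mono fun x => ENNReal.ofReal_le_ofReal (hgh x)))
    (EReal.coe_ennreal_le_coe_ennreal_iff.2
      (lintegral_mono fun x => ENNReal.ofReal_le_ofReal (neg_le_neg (hgh x))))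

lemma extInt_map {X Y : Type*} [MeasurableSpace X] [MeasurableSpace Y] (m : Measure X)
    {T : X → Y} (hT : Measurable T) {g : Y → ℝ} (hg : Measurable g) :
    extInt (m.map T) g = extInt m fun x => g (T x) := by
  rw [extInt, extInt, lintegral_map hg.ennreal_ofReal hT, lintegral_map (by fun_prop) hT]

/-- For a function bounded below by `-B`, the extended integral is that of the nonnegative
function `g + B`, minus `B`. -/
lemma extInt_eq_sub {X : Type*} [MeasurableSpace X] (m : Measure X) [IsProbabilityMeasure m]
    {g : X → ℝ} (hg : Measurable g) (B : ℝ≥0) (hB : ∀ x, -(B : ℝ) ≤ g x) :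
    extInt m g = ((∫⁻ x, ENNReal.ofReal (g x + B) ∂m : ℝ≥0∞) : EReal) - ((B : ℝ) : EReal) := by
  -- The identity `(g + B) + g⁻ = g⁺ + B` is kept additive, so that it survives infinite integrals.
  have hsum : (∫⁻ x, ENNReal.ofReal (g x + B) ∂m) + ∫⁻ x, ENNReal.ofReal (-g x) ∂m =
      (∫⁻ x, ENNReal.ofReal (g x) ∂m) + B := by
    have hconst : (B : ℝ≥0∞) = ∫⁻ _, (B : ℝ≥0∞) ∂m := by simp
    rw [hconst, ← lintegral_add_left (by fun_prop), ← lintegral_add_left (by fun_prop)]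
    refine lintegral_congr fun x => ?_
    have hx := hB x
    rcases le_total 0 (g x) with h | h
    · rw [ENNReal.ofReal_of_nonpos (by linarith : -g x ≤ 0), add_zero,
        ENNReal.ofReal_add h B.coe_nonneg, ENNReal.ofReal_coe_nnreal]
    · rw [ENNReal.ofReal_of_nonpos h, zero_add,
        ← ENNReal.ofReal_add (by linarith) (by linarith)]
      simp
  have hfin : ∫⁻ x, ENNReal.ofReal (-g x) ∂m ≠ ∞ := by
    refine ne_top_of_le_ne_top (ENNReal.coe_ne_top (r := B)) ?_
    calc ∫⁻ x, ENNReal.ofReal (-g x) ∂m ≤ ∫⁻ _, (B : ℝ≥0∞) ∂m := by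
          refine lintegral_mono fun x => ?_
          rw [← ENNReal.ofReal_coe_nnreal]
          exact ENNReal.ofReal_le_ofReal (by linarith [hB x])
      _ = B := by simp
  rw [extInt]
  generalize (∫⁻ x, ENNReal.ofReal (g x + B) ∂m) = Q at *
  generalize (∫⁻ x, ENNReal.ofReal (g x) ∂m) = P at *
  generalize (∫⁻ x, ENNReal.ofReal (-g x) ∂m) = N at *
  lift N to ℝ≥0 using hfin
  rcases eq_or_ne P ∞ with rfl | hP
  · have : Q = ∞ := by
      by_contra hQ
      lift Q to ℝ≥0 using hQ
      rw [top_add] at hsum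
      exact ENNReal.coe_ne_top (r := Q + N) (by simp at hsum)
    subst this
    simp [EReal.coe_nnreal_eq_coe_real]
  · have hQ : Q ≠ ∞ := by
      rintro rfl
      rw [top_add] at hsum
      exact ENNReal.add_ne_top.2 ⟨hP, ENNReal.coe_ne_top⟩ hsum.symm
    lift P to ℝ≥0 using hP
    lift Q to ℝ≥0 using hQ
    have h : (Q : ℝ) + N = P + B := by exact_mod_cast hsum
    simp only [EReal.coe_nnreal_eq_coe_real]
    rw [← EReal.coe_sub, ← EReal.coe_sub, EReal.coe_eq_coe_iff]
    linarith

/-! ### Minimisers and the inner problem -/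

section

variable {S : Type*} [TopologicalSpace S]

lemma lowerSemicontinuous_integrand {f : S → ℝ} (hf : LowerSemicontinuous f)
    {c : S × S → ℝ≥0} (hc : LowerSemicontinuous c) (l : ℝ≥0) :
    LowerSemicontinuous fun p : S × S => f p.2 + l * c p := by
  refine (hf.comp continuous_snd).add ?_
  have hcont : Continuous fun t : ℝ≥0 => (l : ℝ) * t := by fun_prop
  exact hcont.comp_lowerSemicontinuous hc fun s t hst => by
    exact mul_le_mul_of_nonneg_left (NNReal.coe_le_coe.2 hst) l.coe_nonneg

section

variable [PolishSpace S] [MeasurableSpace S] [BorelSpace S]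

lemma measurable_integrand {f : S → ℝ} (hf : LowerSemicontinuous f)
    {c : S × S → ℝ≥0} (hc : LowerSemicontinuous c) (l : ℝ≥0) :
    Measurable fun p : S × S => f p.2 + l * c p :=
  (lowerSemicontinuous_integrand hf hc l).measurable

lemma lintegral_integrand {f : S → ℝ} (hf : LowerSemicontinuous f) {c : S × S → ℝ≥0}
    {B : ℝ≥0} (hB : ∀ y, -(B : ℝ) ≤ f y) (hc : LowerSemicontinuous c) (l : ℝ≥0)
    (π : ProbabilityMeasure (S × S)) :
    ∫⁻ p, ENNReal.ofReal (f p.2 + l * c p + B) ∂(π : Measure (S × S)) =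
      (∫⁻ p, ENNReal.ofReal (f p.2 + B) ∂(π : Measure (S × S))) + l * planCost c π := by
  have hfm : Measurable fun p : S × S => ENNReal.ofReal (f p.2 + B) :=
    ((hf.measurable.comp measurable_snd).add_const _).ennreal_ofReal
  rw [planCost, ← lintegral_const_mul _ hc.measurable.coe_nnreal_ennreal,
    ← lintegral_add_left hfm]
  refine lintegral_congr fun p => ?_
  have := hB p.2
  rw [show f p.2 + l * c p + B = (f p.2 + B) + l * c p by ring,
    ENNReal.ofReal_add (by linarith) (by positivity), ENNReal.ofReal_mul (by positivity),
    ENNReal.ofReal_coe_nnreal, ENNReal.ofReal_coe_nnreal]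

lemma extInt_integrand {f : S → ℝ} (hf : LowerSemicontinuous f) {c : S × S → ℝ≥0}
    {B : ℝ≥0} (hB : ∀ y, -(B : ℝ) ≤ f y) (hc : LowerSemicontinuous c) (l : ℝ≥0)
    (π : ProbabilityMeasure (S × S)) :
    extInt (π : Measure (S × S)) (fun p => f p.2 + l * c p) =
      (((∫⁻ p, ENNReal.ofReal (f p.2 + B) ∂(π : Measure (S × S))) + l * planCost c π : ℝ≥0∞) :
        EReal) - ((B : ℝ) : EReal) := by
  rw [extInt_eq_sub _ (measurable_integrand hf hc l) B, lintegral_integrand hf hB hc]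
  intro p
  have : (0 : ℝ) ≤ l * c p := by positivity
  linarith [hB p.2]

end

variable [CompactSpace S]

/-- The extra condition `-a ≤ B` makes the shifted level `a + B` nonnegative, as the multiplier
argument requires. -/
lemma exists_lowerBound {f : S → ℝ} (hf : LowerSemicontinuous f) (a : ℝ) :
    ∃ B : ℝ≥0, -a ≤ B ∧ ∀ y, -(B : ℝ) ≤ f y := by
  obtain ⟨b, hb⟩ := (hf.lowerSemicontinuousOn Set.univ).bddBelow_of_isCompact isCompact_univ
  refine ⟨(max (-a) (-b)).toNNReal, (le_max_left _ _).trans (Real.le_coe_toNNReal _), fun y => ?_⟩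
  have h1 : -b ≤ (max (-a) (-b)).toNNReal := (le_max_right _ _).trans (Real.le_coe_toNNReal _)
  have h2 : b ≤ f y := hb ⟨y, trivial, rfl⟩
  linarith

/-- The infimum defining `φ_l(x)` is a minimum. -/
lemma isLeast_phi [Nonempty S] {f : S → ℝ} (hf : LowerSemicontinuous f)
    {c : S × S → ℝ≥0} (hc : LowerSemicontinuous c) (l : ℝ≥0) (x : S) :
    IsLeast (Set.range fun y => f y + l * c (x, y)) (phi f c l x) := by
  have hu : LowerSemicontinuous fun y => f y + l * c (x, y) :=
    (lowerSemicontinuous_integrand hf hc l).comp (Continuous.prodMk_right x)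
  obtain ⟨y, -, hy⟩ := argminOn_nonempty isClosed_univ Set.univ_nonempty hu
  have hleast : IsLeast (Set.range fun y => f y + l * c (x, y)) (f y + l * c (x, y)) :=
    ⟨⟨y, rfl⟩, by rintro _ ⟨z, rfl⟩; exact hy z trivial⟩
  rwa [phi, iInf, hleast.csInf_eq]

lemma phi_eq_of_isMinimiserSelection [Nonempty S] {f : S → ℝ} (hf : LowerSemicontinuous f)
    {c : S × S → ℝ≥0} (hc : LowerSemicontinuous c) {l : ℝ≥0} {T : S → S}
    (hT : IsMinimiserSelection f c l T) (x : S) :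
    phi f c l x = f (T x) + l * c (x, T x) :=
  (isLeast_phi hf hc l x).unique ⟨⟨T x, rfl⟩, by rintro _ ⟨z, rfl⟩; exact hT x z⟩

variable [PolishSpace S] [MeasurableSpace S] [BorelSpace S]

/-- Minimisers of `y ↦ f(y) + l c(x,y)` can be chosen in a Borel way. -/
lemma exists_measurable_isMinimiserSelection [Nonempty S] {f : S → ℝ}
    (hf : LowerSemicontinuous f) {c : S × S → ℝ≥0} (hc : LowerSemicontinuous c) (l : ℝ≥0) :
    ∃ T : S → S, Measurable T ∧ IsMinimiserSelection f c l T := by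
  have hh := lowerSemicontinuous_integrand hf hc l
  have hA : IsClosedMeasurable fun x => argminOn Set.univ fun y => f y + l * c (x, y) := by
    refine isClosedMeasurable_argminOn (fun _ => isClosed_univ) (fun _ => Set.univ_nonempty)
      (fun x => hh.comp (Continuous.prodMk_right x)) fun F hF q => ?_
    -- Projecting the closed set `{f(y) + l c(x,y) ≤ q, y ∈ F}` along the compact second factor
    -- gives a closed set of `x`.
    have hcl := isClosedMap_fst_of_compactSpace (X := S) (Y := S) _
      ((hh.isClosed_preimage q).inter (hF.preimage continuous_snd))
    convert hcl.measurableSet using 1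
    ext x
    simp [and_comm]
  obtain ⟨T, hT, hmem⟩ := hA.exists_measurable_selection
  exact ⟨T, hT, fun x y => (hmem x).2 y trivial⟩

/-- An uncountable infimum need not be measurable; here it equals the integrand composed with `x ↦
(x, T x)` for a Borel selection `T`. -/
lemma measurable_phi [Nonempty S] {f : S → ℝ} (hf : LowerSemicontinuous f)
    {c : S × S → ℝ≥0} (hc : LowerSemicontinuous c) (l : ℝ≥0) : Measurable (phi f c l) := by
  obtain ⟨T, hT, hsel⟩ := exists_measurable_isMinimiserSelection hf hc l
  rw [funext (phi_eq_of_isMinimiserSelection hf hc hsel)]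
  exact (measurable_integrand hf hc l).comp (measurable_id.prodMk hT)

end

/-! ### Plans -/

section

variable {S : Type*} [MeasurableSpace S]

lemma map_fst_of_mem_plansFrom {μ : ProbabilityMeasure S} {π : ProbabilityMeasure (S × S)}
    (h : π ∈ plansFrom μ) : (π : Measure (S × S)).map Prod.fst = μ := by
  rw [← ProbabilityMeasure.toMeasure_map π measurable_fst.aemeasurable]
  exact congrArg _ h.1

lemma mem_plansFrom_of_map_fst {μ : ProbabilityMeasure S} {π : ProbabilityMeasure (S × S)}
    (h : (π : Measure (S × S)).map Prod.fst = μ) : π ∈ plansFrom μ :=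
  ⟨Subtype.ext h, trivial⟩

lemma deterministicPlan_mem_plansFrom (μ : ProbabilityMeasure S) {T : S → S}
    (hT : Measurable T) : deterministicPlan μ T hT ∈ plansFrom μ := by
  apply mem_plansFrom_of_map_fst
  rw [deterministicPlan, ProbabilityMeasure.toMeasure_map,
    Measure.map_map measurable_fst (by fun_prop)]
  exact Measure.map_id

/-- Mixtures of plans from `μ` are plans from `μ`. -/
lemma exists_mixture {μ : ProbabilityMeasure S} {π ρ : ProbabilityMeasure (S × S)}
    (hπ : π ∈ plansFrom μ) (hρ : ρ ∈ plansFrom μ) {s t : ℝ≥0} (hst : s + t = 1) :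
    ∃ σ ∈ plansFrom μ, ∀ g : S × S → ℝ≥0∞, ∫⁻ p, g p ∂(σ : Measure (S × S)) =
      s * ∫⁻ p, g p ∂(π : Measure (S × S)) + t * ∫⁻ p, g p ∂(ρ : Measure (S × S)) := by
  have hst' : (s : ℝ≥0∞) + t = 1 := by exact_mod_cast hst
  refine ⟨⟨(s : ℝ≥0∞) • (π : Measure (S × S)) + (t : ℝ≥0∞) • (ρ : Measure (S × S)),
    ⟨by simp [hst']⟩⟩, ?_, fun g => ?_⟩
  · apply mem_plansFrom_of_map_fst
    rw [ProbabilityMeasure.coe_mk, Measure.map_add _ _ measurable_fst, Measure.map_smul,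
      Measure.map_smul, map_fst_of_mem_plansFrom hπ, map_fst_of_mem_plansFrom hρ, ← add_smul,
      hst', one_smul]
  · rw [ProbabilityMeasure.coe_mk, lintegral_add_measure, lintegral_smul_measure,
      lintegral_smul_measure, smul_eq_mul, smul_eq_mul]

end

variable {S : Type*} [TopologicalSpace S] [MeasurableSpace S] [BorelSpace S]

lemma primalValue_le_primalPlanValue {f : S → ℝ} (hf : LowerSemicontinuous f)
    (c : S × S → ℝ≥0) (μ : ProbabilityMeasure S) (r : ℝ) :
    primalValue f c μ r ≤ primalPlanValue f c μ r := by
  refine le_iInf₂ fun π hπ => ?_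
  have hmem : π.map measurable_snd.aemeasurable ∈ uncertaintySet c μ r := by
    have hle : transportCost c μ (π.map measurable_snd.aemeasurable) ≤ planCost c π :=
      iInf₂_le π ⟨hπ.1.1, rfl⟩
    exact hle.trans hπ.2
  refine (iInf₂_le _ hmem).trans_eq ?_
  rw [ProbabilityMeasure.toMeasure_map, extInt_map _ measurable_snd hf.measurable]

variable [PolishSpace S] [CompactSpace S]

/-- The first-marginal map is weakly continuous, and the probability measures on the compact space
`S × S` form a compact space. -/
lemma isCompact_plansFrom (μ : ProbabilityMeasure S) : IsCompact (plansFrom μ) := by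
  have : plansFrom μ = (fun π : ProbabilityMeasure (S × S) =>
      π.map measurable_fst.aemeasurable) ⁻¹' {μ} := by
    ext π; simp [plansFrom, transportPlans]
  rw [this]
  exact (isClosed_singleton.preimage (ProbabilityMeasure.continuous_map continuous_fst)).isCompact

lemma extInt_phi_le {f : S → ℝ} (hf : LowerSemicontinuous f) {c : S × S → ℝ≥0}
    (hc : LowerSemicontinuous c) (l : ℝ≥0) {μ : ProbabilityMeasure S}
    {π : ProbabilityMeasure (S × S)} (hπ : π ∈ plansFrom μ) :
    extInt (μ : Measure S) (phi f c l) ≤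
      extInt (π : Measure (S × S)) (fun p => f p.2 + l * c p) := by
  have : Nonempty S := μ.nonempty
  rw [← map_fst_of_mem_plansFrom hπ, extInt_map _ measurable_fst (measurable_phi hf hc l)]
  exact extInt_mono _ fun p => (isLeast_phi hf hc l p.1).2 ⟨p.2, rfl⟩

lemma extInt_deterministicPlan {f : S → ℝ} (hf : LowerSemicontinuous f) {c : S × S → ℝ≥0}
    (hc : LowerSemicontinuous c) {l : ℝ≥0} (μ : ProbabilityMeasure S) {T : S → S}
    (hT : Measurable T) (hsel : IsMinimiserSelection f c l T) :
    extInt (deterministicPlan μ T hT : Measure (S × S)) (fun p => f p.2 + l * c p) =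
      extInt (μ : Measure S) (phi f c l) := by
  have : Nonempty S := μ.nonempty
  rw [deterministicPlan, ProbabilityMeasure.toMeasure_map,
    extInt_map _ (by fun_prop) (measurable_integrand hf hc l)]
  exact congrArg _ (funext fun x => (phi_eq_of_isMinimiserSelection hf hc hsel x).symm)

/-! ### Duality -/

/-- Weak duality. -/
lemma dualValue_le_primalValue {f : S → ℝ} (hf : LowerSemicontinuous f) {c : S × S → ℝ≥0}
    (hc : LowerSemicontinuous c) (μ : ProbabilityMeasure S) {r : ℝ} (hr : 0 < r) :
    dualValue f c μ r ≤ primalValue f c μ r := by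
  have : Nonempty S := μ.nonempty
  obtain ⟨B, -, hB⟩ := exists_lowerBound hf 0
  refine iSup_le fun l => le_iInf₂ fun ν hν => ?_
  have hphi : ∀ x, -(B : ℝ) ≤ phi f c l x := fun x => by
    obtain ⟨y, hy⟩ := (isLeast_phi hf hc l x).1
    have : (0 : ℝ) ≤ l * c (x, y) := by positivity
    have := hB y
    simp only at hy
    linarith
  rw [extInt_eq_sub _ (measurable_phi hf hc l) B hphi, extInt_eq_sub _ hf.measurable B hB]
  have hplan : ∀ π ∈ transportPlans {μ} {ν},
      ∫⁻ x, ENNReal.ofReal (phi f c l x + B) ∂(μ : Measure S) ≤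
        (∫⁻ y, ENNReal.ofReal (f y + B) ∂(ν : Measure S)) + l * planCost c π := by
    rintro π ⟨hπ1, hπ2⟩
    have h1 : (π : Measure (S × S)).map Prod.fst = μ := map_fst_of_mem_plansFrom ⟨hπ1, trivial⟩
    have h2 : (π : Measure (S × S)).map Prod.snd = ν := by
      rw [← ProbabilityMeasure.toMeasure_map π measurable_snd.aemeasurable]
      exact congrArg _ hπ2
    rw [← h1, ← h2, lintegral_map (by have := measurable_phi hf hc l; fun_prop) measurable_fst,
      lintegral_map (by have := hf.measurable; fun_prop) measurable_snd,
      ← lintegral_integrand hf hB hc]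
    refine lintegral_mono fun p => ENNReal.ofReal_le_ofReal ?_
    have := (isLeast_phi hf hc l p.1).2 ⟨p.2, rfl⟩
    simp only [Prod.mk.eta] at this
    linarith
  have hcost : ∫⁻ x, ENNReal.ofReal (phi f c l x + B) ∂(μ : Measure S) ≤
      (∫⁻ y, ENNReal.ofReal (f y + B) ∂(ν : Measure S)) + l * ENNReal.ofReal r := by
    refine ENNReal.le_of_forall_pos_le_add fun ε hε _ => ?_
    -- The infimum over plans is only approached; dividing by `l + 1` keeps the error at most `ε`
    -- after multiplication by `l`, including for `l = 0`.
    have hlt : transportCost c μ ν < ENNReal.ofReal r + (ε / (l + 1) : ℝ≥0) :=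
      lt_of_le_of_lt hν (ENNReal.lt_add_right ENNReal.ofReal_ne_top (by positivity))
    obtain ⟨π, hπ, hlt⟩ := by simpa only [transportCost, iInf_lt_iff, exists_prop] using hlt
    refine (hplan π hπ).trans ?_
    rw [add_assoc]
    gcongr
    refine (mul_le_mul_right hlt.le _).trans ?_
    rw [mul_add]
    gcongr
    have : l * (ε / (l + 1)) ≤ ε := by
      rw [mul_div_assoc', div_le_iff₀ (by positivity), mul_comm]
      gcongr
      exact le_self_add
    exact_mod_cast this
  generalize (∫⁻ x, ENNReal.ofReal (phi f c l x + B) ∂(μ : Measure S)) = I at *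
  generalize (∫⁻ y, ENNReal.ofReal (f y + B) ∂(ν : Measure S)) = N at *
  rcases eq_or_ne N ∞ with rfl | hN
  · simp only [EReal.coe_ennreal_top, EReal.top_sub_coe, le_top]
  lift r to ℝ≥0 using hr.le
  lift N to ℝ≥0 using hN
  rw [ENNReal.ofReal_coe_nnreal] at hcost
  lift I to ℝ≥0 using ne_top_of_le_ne_top (by finiteness) hcost
  have : (I : ℝ) ≤ N + l * r := by exact_mod_cast hcost
  simp only [EReal.coe_nnreal_eq_coe_real, ← EReal.coe_sub, EReal.coe_le_coe_iff]
  linarith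

/-- Strong duality. -/
lemma primalPlanValue_le_dualValue {f : S → ℝ} (hf : LowerSemicontinuous f)
    {c : S × S → ℝ≥0} (hc : LowerSemicontinuous c) (μ : ProbabilityMeasure S) {r : ℝ}
    (hr : 0 < r) : primalPlanValue f c μ r ≤ dualValue f c μ r := by
  have : Nonempty S := μ.nonempty
  -- Testing with real `a` below the plan value also covers the value `+∞`, in particular an
  -- infeasible primal.
  rw [← EReal.ge_of_forall_gt_iff_ge]
  intro a ha
  obtain ⟨B, haB, hB⟩ := exists_lowerBound hf a
  lift r to ℝ≥0 using hr.le
  obtain ⟨a', ha'⟩ : ∃ a' : ℝ≥0, (a' : ℝ) = a + B := ⟨⟨a + B, by linarith⟩, rfl⟩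
  have hCl : LowerSemicontinuous fun π : ProbabilityMeasure (S × S) => planCost c π := by
    have := lowerSemicontinuous_lintegral (Ω := S × S) (g := fun p => (c p : ℝ))
      (NNReal.continuous_coe.comp_lowerSemicontinuous hc NNReal.coe_mono)
      (fun p => (c p).2)
    simpa only [ENNReal.ofReal_coe_nnreal, planCost] using this
  have hGl : LowerSemicontinuous fun π : ProbabilityMeasure (S × S) =>
      ∫⁻ p, ENNReal.ofReal (f p.2 + B) ∂(π : Measure (S × S)) :=
    lowerSemicontinuous_lintegral (g := fun p : S × S => f p.2 + B)
      ((hf.comp continuous_snd).add continuous_const.lowerSemicontinuous)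
      fun p => by have := hB p.2; simp only [Pi.zero_apply]; linarith
  obtain ⟨l, hl⟩ := exists_multiplier (isCompact_plansFrom μ) hCl hGl (r := r) (a := a')
    (fun π hπ ρ hρ s t hst => by
      obtain ⟨σ, hσ, hint⟩ := exists_mixture hπ hρ hst
      exact ⟨σ, hσ, (hint _).le, (hint _).le⟩) (by exact_mod_cast hr) (fun π hπ hcost => by
      have h1 : (a : EReal) < extInt (π : Measure (S × S)) fun p => f p.2 :=
        ha.trans_le (iInf₂_le π ⟨hπ, by rwa [ENNReal.ofReal_coe_nnreal]⟩)
      rw [extInt_eq_sub _ (g := fun p : S × S => f p.2) (hf.measurable.comp measurable_snd) B fun p => hB p.2] at h1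
      generalize (∫⁻ p, ENNReal.ofReal (f p.2 + B) ∂(π : Measure (S × S))) = N at *
      rcases eq_or_ne N ∞ with rfl | hN
      · simp
      lift N to ℝ≥0 using hN
      simp only [EReal.coe_nnreal_eq_coe_real, ← EReal.coe_sub, EReal.coe_lt_coe_iff] at h1
      have : (a' : ℝ) < N := by linarith
      exact_mod_cast this)
  obtain ⟨T, hT, hsel⟩ := exists_measurable_isMinimiserSelection hf hc l
  refine le_trans ?_ (le_iSup _ l)
  -- The multiplier bound is used at one plan only, where the integral of `f(y) + l c` is `∫ φ_l
  -- dμ`.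
  have h := hl _ (deterministicPlan_mem_plansFrom μ hT)
  rw [← extInt_deterministicPlan hf hc μ hT hsel, extInt_integrand hf hB hc]
  generalize (∫⁻ p, ENNReal.ofReal (f p.2 + B) ∂(deterministicPlan μ T hT : Measure (S × S))) +
    l * planCost c (deterministicPlan μ T hT) = N at *
  rcases eq_or_ne N ∞ with rfl | hN
  · simp only [EReal.coe_ennreal_top, EReal.top_sub_coe, le_top]
  lift N to ℝ≥0 using hN
  have : (a' : ℝ) + l * r ≤ N := by exact_mod_cast h
  simp only [EReal.coe_nnreal_eq_coe_real, ← EReal.coe_sub, EReal.coe_le_coe_iff]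
  linarith

end OTDuality

open OTDuality in
theorem mainTheorem1 {S : Type*} [TopologicalSpace S] [PolishSpace S] [CompactSpace S]
    [MeasurableSpace S] [BorelSpace S]
    (f : S → ℝ) (hf : LowerSemicontinuous f)
    (c : S × S → ℝ≥0) (hc : LowerSemicontinuous c)
    (μ : ProbabilityMeasure S) (r : ℝ) (hr : 0 < r) :
    -- the two forms of the primal problem and the dual problem have the same value
    (primalValue f c μ r = dualValue f c μ r ∧ primalPlanValue f c μ r = dualValue f c μ r) ∧
    -- the infimum defining `φ_l(x)` is a minimum
    (∀ (l : ℝ≥0) (x : S), IsLeast (Set.range fun y => f y + l * c (x, y)) (phi f c l x)) ∧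
    -- measurable selections of minimisers exist, and each of them induces a deterministic
    -- coupling that solves the inner minimisation problem
    (∀ l : ℝ≥0,
      (∃ T : S → S, Measurable T ∧ IsMinimiserSelection f c l T) ∧
      ∀ (T : S → S) (hT : Measurable T), IsMinimiserSelection f c l T →
        deterministicPlan μ T hT ∈ plansFrom μ ∧
        (∀ π ∈ plansFrom μ,
          lagrangian f c r (deterministicPlan μ T hT) l ≤ lagrangian f c r π l) ∧
        lagrangian f c r (deterministicPlan μ T hT) l =
          extInt (μ : Measure S) (phi f c l) - ((l * r : ℝ) : EReal)) := by
  have : Nonempty S := μ.nonempty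
  have h1 := dualValue_le_primalValue hf hc μ hr
  have h2 := primalValue_le_primalPlanValue hf c μ r
  have h3 := primalPlanValue_le_dualValue hf hc μ hr
  refine ⟨⟨le_antisymm (h2.trans h3) h1, le_antisymm h3 (h1.trans h2)⟩, isLeast_phi hf hc,
    fun l => ⟨exists_measurable_isMinimiserSelection hf hc l, fun T hT hsel =>
      ⟨deterministicPlan_mem_plansFrom μ hT, fun π hπ => ?_, ?_⟩⟩⟩
  · rw [lagrangian, extInt_deterministicPlan hf hc μ hT hsel]
    exact EReal.sub_le_sub (extInt_phi_le hf hc l hπ) le_rfl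
  · rw [lagrangian, extInt_deterministicPlan hf hc μ hT hsel]
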